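/- All Hilbert spaces are complex and separable (finite or countably infinite dimensional), \(\mathcal L(\mathcal H)\) denotes the bounded operators on \(\mathcal H\), \(\otimes\) is the Hilbert space tensor product, and outcome sets \(\Omega\) are finite. An \emph{effect} on \(\mathcal H\) is an operator \(E\in\mathcal L(\mathcal H)\) with \(0\le E\le 1\). An \emph{operation} (Heisenberg picture) is a normal completely positive linear map \(\Phi:\mathcal L(\mathcal K)\to\mathcal L(\mathcal H)\) with \(\Phi(1)\le 1\); it is a \emph{channel} if \(\Phi(1)=1\). An \emph{instrument} on \(\Omega\) is a family \((\mathcal I(x,\cdot))_{x\in\Omega}\) of operations \(\mathcal L(\mathcal K)\to\mathcal L(\mathcal H)\) whose sum is a channel; put \(\mathcal I(X,\cdot)=\sum_{x\in X}\mathcal I(x,\cdot)\) for \(X\subseteq\Omega\). An operation \(\Phi\) is \emph{part of} \(\mathcal I\) if \(\Phi=\mathcal I(X,\cdot)\) for some \(X\subseteq\Omega\), and an effect \(E\) is \emph{part of} \(\mathcal I\) if \(E=\mathcal I(X,1)\) for some \(X\subseteq\Omega\). Two operations \(\mathcal L(\mathcal K)\to\mathcal L(\mathcal H)\) are \emph{compatible}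 if both are parts of one instrument \(\Omega\times\mathcal L(\mathcal K)\to\mathcal L(\mathcal H)\), and \emph{weakly compatible} if they are parts of instruments \(\mathcal I_1\) on \(\Omega_1\) and \(\mathcal I_2\) on \(\Omega_2\), respectively, with \(\mathcal I_1(\Omega_1,\cdot)=\mathcal I_2(\Omega_2,\cdot)\). Two effects on \(\mathcal H\) are \emph{compatible} if both are parts of one instrument \(\Omega\times\mathcal L(\mathcal L_0)\to\mathcal L(\mathcal H)\) for some output Hilbert space \(\mathcal L_0\). \textbf{Proposition.} Let \(\Phi_1,\Phi_2:\mathcal L(\mathcal K)\to\mathcal L(\mathcal H)\) be operations. (a) \(\Phi_1\) and \(\Phi_2\) are compatible if and only if there exist a Hilbert space \(\mathcal K'\), an isometry \(V:\mathcal H\to\mathcal K\otimes\mathcal K'\) and compatible effects \(E,F\in\mathcal L(\mathcal K')\) such that \[\Phi_1(T)=V^*(T\otimes E)V,\qquad \Phi_2(T)=V^*(T\otimes F)V\qquad\text{for all }T\in\mathcal L(\mathcal K).\] (b) \(\Phi_1\) and \(\Phi_2\) are weakly compatible if and only if there exist a Hilbert space \(\mathcal K'\), an isometry \(V:\mathcal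 H\to\mathcal K\otimes\mathcal K'\) and (not necessarily compatible) effects \(E,F\in\mathcal L(\mathcal K')\) satisfying the same two equations for all \(T\in\mathcal L(\mathcal K)\). -/

import Mathlib

open TopologicalSpace
open scoped TensorProduct

universe u v

namespace QuantumDevice

section Tensor

variable {K : Type u} {K' : Type v}
  [NormedAddCommGroup K] [InnerProductSpace ℂ K]
  [NormedAddCommGroup K'] [InnerProductSpace ℂ K']

/-- The Hilbert space tensor product: the completion of the algebraic tensor product with respect
to the inner product `⟪x ⊗ y, x' ⊗ y'⟫ = ⟪x, x'⟫ * ⟪y, y'⟫`. -/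
abbrev HilbertTensor (K : Type u) (K' : Type v)
    [NormedAddCommGroup K] [InnerProductSpace ℂ K]
    [NormedAddCommGroup K'] [InnerProductSpace ℂ K'] : Type (max u v) :=
  UniformSpace.Completion (K ⊗[ℂ] K')

/-- The bounded operator `T ⊗ E` on the Hilbert space tensor product: the continuous extension of
`x ⊗ y ↦ T x ⊗ E y`. -/
noncomputable def opTensor (T : K →L[ℂ] K) (E : K' →L[ℂ] K') :
    HilbertTensor K K' →L[ℂ] HilbertTensor K K' :=
  (TensorProduct.mapL T E).completion

theorem opTensor_coe_tmul (T : K →L[ℂ] K) (E : K' →L[ℂ] K') (x : K) (y : K') :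
    opTensor T E ((x ⊗ₜ[ℂ] y : K ⊗[ℂ] K') : HilbertTensor K K') =
      ((T x ⊗ₜ[ℂ] E y : K ⊗[ℂ] K') : HilbertTensor K K') := by
  simp [opTensor]

end Tensor

section Devices

variable {H : Type u} {K : Type v}
  [NormedAddCommGroup H] [InnerProductSpace ℂ H] [CompleteSpace H]
  [NormedAddCommGroup K] [InnerProductSpace ℂ K] [CompleteSpace K]

/-- An effect: an operator `E` with `0 ≤ E ≤ 1` in the Loewner order. -/
def IsEffect (E : H →L[ℂ] H) : Prop := 0 ≤ E ∧ E ≤ 1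

/-- Complete positivity of a linear map `𝓛(K) → 𝓛(H)`, in the sense of C⋆-algebras. -/
def IsCompletelyPositive (Φ : (K →L[ℂ] K) →ₗ[ℂ] (H →L[ℂ] H)) : Prop :=
  ∃ Ψ : CompletelyPositiveMap (K →L[ℂ] K) (H →L[ℂ] H), Ψ.toLinearMap = Φ

/-- Normality of a (positive) linear map `𝓛(K) → 𝓛(H)`: it preserves the least upper bounds of
bounded upward directed families of self-adjoint operators. -/
def IsNormalMap (Φ : (K →L[ℂ] K) →ₗ[ℂ] (H →L[ℂ] H)) : Prop :=
  ∀ (S : Set (K →L[ℂ] K)) (T : K →L[ℂ] K), S.Nonempty → DirectedOn (· ≤ ·) S →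
    (∀ A ∈ S, IsSelfAdjoint A) → IsLUB S T → IsLUB (Φ '' S) (Φ T)

/-- An operation in the Heisenberg picture, with input space `H` and output space `K`: a normal
completely positive map `Φ : 𝓛(K) → 𝓛(H)` with `Φ(1) ≤ 1`. -/
structure IsOperation (Φ : (K →L[ℂ] K) →ₗ[ℂ] (H →L[ℂ] H)) : Prop where
  completelyPositive : IsCompletelyPositive Φ
  normal : IsNormalMap Φ
  map_one_le : Φ 1 ≤ 1

/-- A channel: an operation with `Λ(1) = 1`. -/
structure IsChannel (Λ : (K →L[ℂ] K) →ₗ[ℂ] (H →L[ℂ] H)) : Prop where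
  operation : IsOperation Λ
  map_one : Λ 1 = 1

/-- An instrument with finite outcome set `Ω`: a family of operations whose sum is a channel. -/
structure IsInstrument {Ω : Type} [Fintype Ω]
    (I : Ω → (K →L[ℂ] K) →ₗ[ℂ] (H →L[ℂ] H)) : Prop where
  operation : ∀ x, IsOperation (I x)
  channel : IsChannel (∑ x, I x)

/-- The effect `E` is part of the instrument `I`: `E = I(X, 1)` for some set `X` of outcomes. -/
def EffectIsPartOf {Ω : Type} (E : H →L[ℂ] H)
    (I : Ω → (K →L[ℂ] K) →ₗ[ℂ] (H →L[ℂ] H)) : Prop :=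
  ∃ X : Finset Ω, E = (∑ x ∈ X, I x) 1

/-- The operation `Φ` is part of the instrument `I`: `Φ = I(X, ·)` for some set `X` of outcomes. -/
def OperationIsPartOf {Ω : Type} (Φ : (K →L[ℂ] K) →ₗ[ℂ] (H →L[ℂ] H))
    (I : Ω → (K →L[ℂ] K) →ₗ[ℂ] (H →L[ℂ] H)) : Prop :=
  ∃ X : Finset Ω, Φ = ∑ x ∈ X, I x

/-- Two operations are compatible if some instrument has both of them as its parts. -/
def OperationsCompatible (Φ₁ Φ₂ : (K →L[ℂ] K) →ₗ[ℂ] (H →L[ℂ] H)) : Prop :=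
  ∃ (Ω : Type) (_ : Fintype Ω) (I : Ω → (K →L[ℂ] K) →ₗ[ℂ] (H →L[ℂ] H)),
    IsInstrument I ∧ OperationIsPartOf Φ₁ I ∧ OperationIsPartOf Φ₂ I

/-- Two operations are weakly compatible if they are parts of two instruments that have the same
total channel. -/
def OperationsWeaklyCompatible (Φ₁ Φ₂ : (K →L[ℂ] K) →ₗ[ℂ] (H →L[ℂ] H)) : Prop :=
  ∃ (Ω₁ : Type) (_ : Fintype Ω₁) (Ω₂ : Type) (_ : Fintype Ω₂)
    (I₁ : Ω₁ → (K →L[ℂ] K) →ₗ[ℂ] (H →L[ℂ] H)) (I₂ : Ω₂ → (K →L[ℂ] K) →ₗ[ℂ] (H →L[ℂ] H)),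
    IsInstrument I₁ ∧ IsInstrument I₂ ∧ OperationIsPartOf Φ₁ I₁ ∧ OperationIsPartOf Φ₂ I₂ ∧
      ∑ x, I₁ x = ∑ x, I₂ x

/-- Two effects on `H` are compatible if some instrument with input space `H`, and with some
separable output Hilbert space `L`, has both of them as its parts. -/
def EffectsCompatible (E F : H →L[ℂ] H) : Prop :=
  ∃ (L : Type u) (_ : NormedAddCommGroup L) (_ : InnerProductSpace ℂ L) (_ : CompleteSpace L)
    (_ : SeparableSpace L) (Ω : Type) (_ : Fintype Ω)
    (I : Ω → (L →L[ℂ] L) →ₗ[ℂ] (H →L[ℂ] H)),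
    IsInstrument I ∧ EffectIsPartOf E I ∧ EffectIsPartOf F I

end Devices

end QuantumDevice

/-! Fix a channel `Λ` and a Hilbert basis `b` of `K`. The Choi form of `Λ` is positive semidefinite,
and on its Hilbert space `K'`, with canonical map `q`, the series `V x = ∑ b i ⊗ q (single i x)`
defines a Stinespring isometry. An outcome of an instrument with total channel `Λ` has a Choi form
dominated by that of `Λ`, hence given by some `G ≥ 0` on `K'` (`exists_radonNikodym`). Normality
carries the identity from matrix units to `V* (T ⊗ G) V` for all `T` (`tendsto_compression`,
`inner_opTensor_of_hasSum`), and these `G` sum to `1`.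

So all instruments with total channel `Λ` come from POVMs on one ancilla (`exists_common_dilation`):
a single POVM gives compatible effects, two POVMs give the weak version.

Conversely, every POVM on `K'` gives an instrument with total channel `V* (· ⊗ 1) V`
(`isInstrument_dilate`). Compatible effects are sums from the POVM `I x 1` of a common instrument
`I`; arbitrary effects use the POVMs `E, 1 - E` and `F, 1 - F`. -/

namespace QuantumDevice

open Filter Topology
open scoped InnerProductSpace ComplexOrder

/-! ### Loewner order and monotone nets of operators -/

section Order

variable {H : Type*} [NormedAddCommGroup H] [InnerProductSpace ℂ H]

theorem nonneg_iff_forall_inner {A : H →L[ℂ] H} : 0 ≤ A ↔ ∀ x, 0 ≤ ⟪x, A x⟫_ℂ := by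
  rw [ContinuousLinearMap.nonneg_iff_isPositive]
  refine ⟨fun h x => h.inner_nonneg_right x, fun h => ?_⟩
  rw [ContinuousLinearMap.isPositive_iff_complex]
  intro x
  have h1 : 0 ≤ ⟪A x, x⟫_ℂ := by
    rw [← inner_conj_symm]; exact star_nonneg_iff.2 (h x)
  rw [Complex.nonneg_iff] at h1
  exact ⟨Complex.ext (by simp) (by simpa using h1.2), h1.1⟩

theorem le_iff_forall_inner {A B : H →L[ℂ] H} :
    A ≤ B ↔ ∀ x, ⟪x, A x⟫_ℂ ≤ ⟪x, B x⟫_ℂ := by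
  rw [ContinuousLinearMap.le_def, ← ContinuousLinearMap.nonneg_iff_isPositive,
    nonneg_iff_forall_inner]
  simp

variable [CompleteSpace H]

/-- Upgrades convergence of quadratic forms along a monotone net to strong convergence. -/
theorem norm_apply_sq_le_of_nonneg {C : H →L[ℂ] H} (hC : 0 ≤ C) (x : H) :
    ‖C x‖ ^ 2 ≤ ‖C‖ * (⟪x, C x⟫_ℂ).re := by
  obtain ⟨D, rfl⟩ := CStarAlgebra.nonneg_iff_eq_star_mul_self.1 hC
  have h1 : (⟪x, (star D * D) x⟫_ℂ).re = ‖D x‖ ^ 2 := by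
    rw [mul_apply_eq_comp, ContinuousLinearMap.star_eq_adjoint,
      ContinuousLinearMap.adjoint_inner_right, inner_self_eq_norm_sq_to_K]
    norm_cast
  rw [h1, CStarRing.norm_star_mul_self, ← sq, ← mul_pow]
  gcongr
  calc ‖(star D * D) x‖ ≤ ‖star D‖ * ‖D x‖ := (star D).le_opNorm _
    _ = ‖D‖ * ‖D x‖ := by rw [norm_star]

variable {ι : Type*} [Preorder ι]

theorem norm_le_of_monotone_isLUB {A : ι → H →L[ℂ] H} {T : H →L[ℂ] H} (hA : Monotone A)
    (hT : IsLUB (Set.range A) T) {i j k : ι} (hij : i ≤ j) (hjk : j ≤ k) :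
    ‖A k - A j‖ ≤ ‖T - A i‖ := by
  refine CStarAlgebra.norm_le_norm_of_nonneg_of_le (sub_nonneg.2 (hA hjk)) ?_
  exact sub_le_sub (hT.1 ⟨k, rfl⟩) (hA hij)

variable [IsDirectedOrder ι] [Nonempty ι]

theorem exists_tendsto_of_monotone_isLUB {A : ι → H →L[ℂ] H} {T : H →L[ℂ] H} (hA : Monotone A)
    (hT : IsLUB (Set.range A) T) (x : H) : ∃ y, Tendsto (fun i => A i x) atTop (𝓝 y) := by
  obtain ⟨i₀⟩ := ‹Nonempty ι›
  refine CompleteSpace.complete (f := map (fun i => A i x) atTop)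
    (Metric.cauchy_iff.2 ⟨inferInstance, fun ε hε => ?_⟩)
  set M := ‖T - A i₀‖
  set r : ι → ℝ := fun i => (⟪x, A i x⟫_ℂ).re with hr
  have hmono : Monotone r := fun i j h => (Complex.le_def.1 (le_iff_forall_inner.1 (hA h) x)).1
  have hbdd : BddAbove (Set.range r) := ⟨(⟪x, T x⟫_ℂ).re, by
    rintro _ ⟨i, rfl⟩
    exact (Complex.le_def.1 (le_iff_forall_inner.1 (hT.1 ⟨i, rfl⟩) x)).1⟩
  have hlim := tendsto_atTop_ciSup hmono hbdd
  -- Chosen so that `M * δ < (ε / 2) ^ 2`; the `+ 1` covers `M = 0`.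
  set δ : ℝ := (ε / 2) ^ 2 / (M + 1) with hδ
  have hMnn : 0 ≤ M := norm_nonneg _
  have hδ0 : 0 < δ := by positivity
  have hlt : ∀ᶠ i in atTop, (⨆ i, r i) - δ < r i :=
    hlim.eventually (lt_mem_nhds (by linarith))
  obtain ⟨j, hj, hij⟩ := (hlt.and (eventually_ge_atTop i₀)).exists
  have key : ∀ k, j ≤ k → dist (A k x) (A j x) < ε / 2 := by
    intro k hk
    have h1 := norm_apply_sq_le_of_nonneg (sub_nonneg.2 (hA hk)) x
    have h2 : (⟪x, (A k - A j) x⟫_ℂ).re = r k - r j := by simp [hr]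
    have h3 : r k ≤ ⨆ i, r i := le_ciSup hbdd k
    have h4 := norm_le_of_monotone_isLUB hA hT hij hk
    have h5 : ‖A k x - A j x‖ ^ 2 ≤ M * δ := by
      rw [h2, sub_apply] at h1
      refine h1.trans (mul_le_mul h4 (by linarith) (sub_nonneg.2 (hmono hk)) hMnn)
    have h6 : M * δ < (ε / 2) ^ 2 := by
      rw [hδ, mul_div_assoc', div_lt_iff₀ (by linarith)]
      nlinarith [pow_pos (half_pos hε) 2]
    rw [dist_eq_norm]
    exact lt_of_pow_lt_pow_left₀ 2 (by positivity) (h5.trans_lt h6)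
  refine ⟨(fun i => A i x) '' Set.Ici j, image_mem_map (Ici_mem_atTop j), ?_⟩
  rintro _ ⟨k, hk, rfl⟩ _ ⟨l, hl, rfl⟩
  calc dist (A k x) (A l x) ≤ dist (A k x) (A j x) + dist (A l x) (A j x) :=
        dist_triangle_right _ _ _
    _ < ε := by linarith [key k hk, key l hl]

/-- Vigier's theorem: a monotone net of operators that has a least upper bound converges to it
strongly. -/
theorem tendsto_apply_of_monotone_isLUB {A : ι → H →L[ℂ] H} {T : H →L[ℂ] H} (hA : Monotone A)
    (hT : IsLUB (Set.range A) T) (x : H) : Tendsto (fun i => A i x) atTop (𝓝 (T x)) := by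
  choose L hL using exists_tendsto_of_monotone_isLUB hA hT
  obtain ⟨i₀⟩ := ‹Nonempty ι›
  -- The pointwise limit is bounded because the norms are uniformly bounded past `i₀`.
  let B : H →L[ℂ] H := (linearMapOfTendsto L (fun i => (A i).toLinearMap)
    (tendsto_pi_nhds.2 hL)).mkContinuous (‖T - A i₀‖ + ‖A i₀‖) (fun y => by
      refine le_of_tendsto (hL y).norm ?_
      filter_upwards [eventually_ge_atTop i₀] with i hi
      refine (A i).le_of_opNorm_le ?_ y
      calc ‖A i‖ = ‖(A i - A i₀) + A i₀‖ := by simp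
        _ ≤ _ := (norm_add_le _ _).trans (by
          gcongr; exact norm_le_of_monotone_isLUB hA hT le_rfl hi))
  have hB : ∀ y, B y = L y := fun y => rfl
  have hlim : ∀ y, Tendsto (fun i => ⟪y, A i y⟫_ℂ) atTop (𝓝 ⟪y, B y⟫_ℂ) := fun y =>
    (tendsto_const_nhds (x := y)).inner (hL y)
  have h1 : T ≤ B := by
    refine hT.2 ?_
    rintro _ ⟨i, rfl⟩
    refine le_iff_forall_inner.2 fun y => ge_of_tendsto (hlim y) ?_
    filter_upwards [eventually_ge_atTop i] with j hj using le_iff_forall_inner.1 (hA hj) y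
  have h2 : B ≤ T := le_iff_forall_inner.2 fun y => le_of_tendsto (hlim y)
    (Eventually.of_forall fun i => le_iff_forall_inner.1 (hT.1 ⟨i, rfl⟩) y)
  rw [le_antisymm h1 h2]
  exact hL x

end Order

/-! ### Normal maps and finite-rank projections -/

section Normal

variable {H K : Type*}
  [NormedAddCommGroup H] [InnerProductSpace ℂ H] [NormedAddCommGroup K] [InnerProductSpace ℂ K]

theorem isLUB_range_of_tendsto_inner {ι : Type*} [Preorder ι] [IsDirectedOrder ι] [Nonempty ι]
    {A : ι → H →L[ℂ] H} {T : H →L[ℂ] H} (hle : ∀ i, A i ≤ T)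
    (hlim : ∀ x, Tendsto (fun i => ⟪x, A i x⟫_ℂ) atTop (𝓝 ⟪x, T x⟫_ℂ)) :
    IsLUB (Set.range A) T := by
  refine ⟨by rintro _ ⟨i, rfl⟩; exact hle i, fun U hU => ?_⟩
  exact le_iff_forall_inner.2 fun y => le_of_tendsto (hlim y)
    (Eventually.of_forall fun i => le_iff_forall_inner.1 (hU ⟨i, rfl⟩) y)

variable {ι : Type*} (b : HilbertBasis ι ℂ K)

/-- The orthogonal projection onto the span of finitely many vectors of a Hilbert basis. -/
noncomputable def basisProj (s : Finset ι) : K →L[ℂ] K :=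
  ∑ i ∈ s, InnerProductSpace.rankOne ℂ (b i) (b i)

theorem inner_basisProj (s : Finset ι) (x y : K) :
    ⟪x, basisProj b s y⟫_ℂ = ∑ i ∈ s, ⟪x, b i⟫_ℂ * ⟪b i, y⟫_ℂ := by
  simp only [basisProj, sum_apply, inner_sum,
    InnerProductSpace.rankOne_apply, inner_smul_right, mul_comm]

theorem basisProj_mono : Monotone (basisProj b) := by
  intro s t h
  rw [le_iff_forall_inner]
  intro x
  rw [inner_basisProj, inner_basisProj]
  refine Finset.sum_le_sum_of_subset_of_nonneg h fun i _ _ => ?_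
  rw [← inner_conj_symm x (b i), mul_comm]
  exact mul_star_self_nonneg _

theorem tendsto_inner_basisProj (x : K) :
    Tendsto (fun s => ⟪x, basisProj b s x⟫_ℂ) atTop (𝓝 ⟪x, x⟫_ℂ) := by
  simp_rw [inner_basisProj]
  exact b.hasSum_inner_mul_inner x x

theorem basisProj_le_one (s : Finset ι) : basisProj b s ≤ 1 :=
  le_iff_forall_inner.2 fun x => ge_of_tendsto (tendsto_inner_basisProj b x) (by
    filter_upwards [eventually_ge_atTop s] with t ht
      using le_iff_forall_inner.1 (basisProj_mono b ht) x)

theorem isLUB_basisProj : IsLUB (Set.range (basisProj b)) 1 :=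
  isLUB_range_of_tendsto_inner (basisProj_le_one b) (tendsto_inner_basisProj b)

theorem basisProj_mul_self (s : Finset ι) : basisProj b s * basisProj b s = basisProj b s := by
  classical
  refine ContinuousLinearMap.ext fun x => ext_inner_left ℂ fun y => ?_
  rw [mul_apply_eq_comp, inner_basisProj, inner_basisProj]
  refine Finset.sum_congr rfl fun i hi => ?_
  rw [inner_basisProj]
  simp [orthonormal_iff_ite.1 b.orthonormal, hi]

theorem basisProj_mul_mul_basisProj (T : K →L[ℂ] K) (s : Finset ι) :
    basisProj b s * T * basisProj b s =
      ∑ i ∈ s, ∑ j ∈ s, ⟪b i, T (b j)⟫_ℂ • InnerProductSpace.rankOne ℂ (b i) (b j) := by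
  refine ContinuousLinearMap.ext fun y => ?_
  simp only [basisProj, mul_apply_eq_comp, sum_apply, map_sum, smul_apply,
    InnerProductSpace.rankOne_apply, map_smul, Finset.smul_sum, smul_smul]
  rw [Finset.sum_comm]
  refine Finset.sum_congr rfl fun i _ => Finset.sum_congr rfl fun j _ => ?_
  rw [mul_comm]

variable [CompleteSpace K]

theorem basisProj_isSelfAdjoint (s : Finset ι) : IsSelfAdjoint (basisProj b s) := by
  have h : 0 ≤ basisProj b s := by
    simpa [basisProj] using basisProj_mono b (Finset.empty_subset s)
  exact .of_nonneg h

/-- A monotone linear map is normal as soon as it maps bounded, strongly convergent monotone nets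
to weakly convergent ones. -/
theorem isNormalMap_of_tendsto {Φ : (K →L[ℂ] K) →ₗ[ℂ] (H →L[ℂ] H)} (hmono : Monotone Φ)
    (h : ∀ (S : Set (K →L[ℂ] K)) (T : K →L[ℂ] K) (M : ℝ),
      (∀ᶠ A : S in atTop, ‖A.1‖ ≤ M) →
      (∀ y, Tendsto (fun A : S => A.1 y) atTop (𝓝 (T y))) →
      ∀ x, Tendsto (fun A : S => ⟪x, Φ A.1 x⟫_ℂ) atTop (𝓝 ⟪x, Φ T x⟫_ℂ)) :
    IsNormalMap Φ := by
  intro S T hne hdir _ hT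
  have : Nonempty S := hne.to_subtype
  have : IsDirectedOrder S := ⟨fun a b => by
    obtain ⟨c, hc, hac, hbc⟩ := hdir a a.2 b b.2
    exact ⟨⟨c, hc⟩, hac, hbc⟩⟩
  have hT' : IsLUB (Set.range (Subtype.val : S → K →L[ℂ] K)) T := by simpa using hT
  have hm : Monotone (Subtype.val : S → K →L[ℂ] K) := Subtype.mono_coe _
  obtain ⟨A₀⟩ : Nonempty S := inferInstance
  -- Only eventual: `S` need not be bounded below.
  have hbd : ∀ᶠ A : S in atTop, ‖A.1‖ ≤ ‖T - A₀.1‖ + ‖A₀.1‖ := by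
    filter_upwards [eventually_ge_atTop A₀] with A hA
    calc ‖A.1‖ = ‖(A.1 - A₀.1) + A₀.1‖ := by simp
        _ ≤ _ := (norm_add_le _ _).trans (by
          gcongr; exact norm_le_of_monotone_isLUB hm hT' le_rfl hA)
  rw [Set.image_eq_range]
  exact isLUB_range_of_tendsto_inner (fun A => hmono (hT.1 A.2))
    (h S T _ hbd (tendsto_apply_of_monotone_isLUB hm hT'))

variable [CompleteSpace H]

theorem IsNormalMap.tendsto_basisProj {Φ : (K →L[ℂ] K) →ₗ[ℂ] (H →L[ℂ] H)} (hΦ : IsNormalMap Φ)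
    (hmono : Monotone Φ) (x : H) :
    Tendsto (fun s => ⟪x, Φ (basisProj b s) x⟫_ℂ) atTop (𝓝 ⟪x, Φ 1 x⟫_ℂ) := by
  have h := hΦ _ _ (Set.range_nonempty (basisProj b))
    (directedOn_range.2 (basisProj_mono b).directed_le)
    (by rintro _ ⟨s, rfl⟩; exact basisProj_isSelfAdjoint b s) (isLUB_basisProj b)
  rw [← Set.range_comp] at h
  exact tendsto_const_nhds.inner
    (tendsto_apply_of_monotone_isLUB (hmono.comp (basisProj_mono b)) h x)

end Normal

/-! ### A positivity test in C⋆-algebras -/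

section NegativePart

variable {A : Type*} [CStarAlgebra A] [PartialOrder A] [StarOrderedRing A]

theorem exists_eq_star_mul_self_of_nonneg {a : A} (ha : 0 ≤ a) : ∃ b, a = star b * b :=
  CStarAlgebra.nonneg_iff_eq_star_mul_self.1 ha

/-- A self-adjoint element is nonnegative once a certain witness of its negative part, which is
a square root of minus a compression of it, vanishes. -/
theorem exists_compression_eq_neg_star_mul_self {a : A} (ha : IsSelfAdjoint a) :
    ∃ c d : A, star c * a * c = -(star d * d) ∧ (d = 0 → 0 ≤ a) := by
  have hN0 : 0 ≤ a⁻ := CFC.negPart_nonneg a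
  have hsa : star a⁻ = a⁻ := (IsSelfAdjoint.of_nonneg hN0).star_eq
  have hNa : a⁻ * a = -(a⁻ * a⁻) := by
    calc a⁻ * a = a⁻ * (a⁺ - a⁻) := by rw [CFC.posPart_sub_negPart a ha]
      _ = _ := by rw [mul_sub, CFC.negPart_mul_posPart, zero_sub]
  obtain ⟨r, hr⟩ := exists_eq_star_mul_self_of_nonneg hN0
  -- Compressing by `a⁻` gives `-(a⁻)³`. If `r * a⁻ = 0`, then `(a⁻)² = star r * (r * a⁻) = 0`.
  refine ⟨a⁻, r * a⁻, ?_, fun h0 => ?_⟩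
  · have : star (r * a⁻) * (r * a⁻) = a⁻ * (star r * r) * a⁻ := by
      rw [star_mul, hsa]; simp only [mul_assoc]
    rw [this, ← hr, hsa, hNa, neg_mul]
  · have hNN : star a⁻ * a⁻ = 0 := by
      calc star a⁻ * a⁻ = star r * r * a⁻ := by rw [hsa, ← hr]
        _ = 0 := by rw [mul_assoc, h0, mul_zero]
    rw [← CFC.posPart_sub_negPart a ha, CStarRing.star_mul_self_eq_zero_iff _ |>.1 hNN, sub_zero]
    exact CFC.posPart_nonneg a

end NegativePart

/-! ### Operator matrices and complete positivity -/

section CompletelyPositive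

variable {n : Type*} [Fintype n] {H K : Type*}
  [NormedAddCommGroup H] [InnerProductSpace ℂ H]
  [NormedAddCommGroup K] [InnerProductSpace ℂ K]

/-- The action of a matrix of operators on a tuple of vectors. -/
def matAct (M : CStarMatrix n n (H →L[ℂ] H)) (f : n → H) : n → H := fun i => ∑ j, M i j (f j)

theorem matAct_mul (M N : CStarMatrix n n (H →L[ℂ] H)) (f : n → H) :
    matAct (M * N) f = matAct M (matAct N f) := by
  funext i
  simp only [matAct, CStarMatrix.mul_apply, sum_apply, map_sum, mul_apply_eq_comp]
  exact Finset.sum_comm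

theorem matAct_neg (M : CStarMatrix n n (H →L[ℂ] H)) (f : n → H) :
    matAct (-M) f = -matAct M f := by
  funext i
  simp [matAct]

theorem eq_zero_of_matAct_eq_zero {M : CStarMatrix n n (H →L[ℂ] H)} (h : ∀ f, matAct M f = 0) :
    M = 0 := by
  classical
  ext i j x
  have := congrFun (h (Pi.single j x)) i
  rw [matAct, Finset.sum_eq_single j] at this
  · simpa using this
  · intro k _ hk
    simp [Pi.single_eq_of_ne hk]
  · simp

variable [CompleteSpace H]

theorem sum_inner_matAct_star (M : CStarMatrix n n (H →L[ℂ] H)) (f g : n → H) :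
    ∑ i, ⟪f i, matAct (star M) g i⟫_ℂ = ∑ i, ⟪matAct M f i, g i⟫_ℂ := by
  simp only [matAct, inner_sum, sum_inner, CStarMatrix.star_apply,
    ContinuousLinearMap.star_eq_adjoint, ContinuousLinearMap.adjoint_inner_right]
  exact Finset.sum_comm

theorem sum_inner_matAct_star_mul_self (M : CStarMatrix n n (H →L[ℂ] H)) (f : n → H) :
    ∑ i, ⟪f i, matAct (star M * M) f i⟫_ℂ = ((∑ i, ‖matAct M f i‖ ^ 2 : ℝ) : ℂ) := by
  rw [matAct_mul, sum_inner_matAct_star]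
  push_cast
  exact Finset.sum_congr rfl fun i _ => inner_self_eq_norm_sq_to_K _

theorem sum_inner_matAct_nonneg {M : CStarMatrix n n (H →L[ℂ] H)} (hM : 0 ≤ M) (f : n → H) :
    0 ≤ ∑ i, ⟪f i, matAct M f i⟫_ℂ := by
  classical
  obtain ⟨N, rfl⟩ := exists_eq_star_mul_self_of_nonneg hM
  rw [sum_inner_matAct_star_mul_self]
  exact Complex.zero_le_real.2 (Finset.sum_nonneg fun i _ => sq_nonneg _)

/-- Testing the form on `matAct c f` yields `0 ≤ -∑ ‖d f‖²`, so the witness `d` of the negative part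
kills every tuple. -/
theorem nonneg_of_sum_inner_matAct_nonneg {M : CStarMatrix n n (H →L[ℂ] H)}
    (hM : IsSelfAdjoint M) (h : ∀ f, 0 ≤ ∑ i, ⟪f i, matAct M f i⟫_ℂ) : 0 ≤ M := by
  classical
  obtain ⟨c, d, hcd, hd⟩ := exists_compression_eq_neg_star_mul_self hM
  refine hd (eq_zero_of_matAct_eq_zero fun f => ?_)
  have h1 := h (matAct c f)
  rw [← sum_inner_matAct_star, ← matAct_mul, ← matAct_mul, hcd, matAct_neg] at h1
  simp only [Pi.neg_apply, inner_neg_right, Finset.sum_neg_distrib] at h1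
  rw [sum_inner_matAct_star_mul_self, ← Complex.ofReal_neg, Complex.zero_le_real] at h1
  have h2 : ∑ i, ‖matAct d f i‖ ^ 2 = 0 :=
    le_antisymm (by linarith) (Finset.sum_nonneg fun i _ => sq_nonneg _)
  funext i
  simpa using (Finset.sum_eq_zero_iff_of_nonneg (fun i _ => sq_nonneg _)).1 h2 i
    (Finset.mem_univ i)

variable [CompleteSpace K]

/-- Maps of the form `T ↦ W* π(T) W` with a *-homomorphism `π` are completely positive. -/
theorem isCompletelyPositive_of_dilation {L : Type*} [NormedAddCommGroup L]
    [InnerProductSpace ℂ L] [CompleteSpace L] (π : (K →L[ℂ] K) →⋆ₐ[ℂ] (L →L[ℂ] L))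
    (W : H →L[ℂ] L) (Φ : (K →L[ℂ] K) →ₗ[ℂ] (H →L[ℂ] H))
    (hΦ : ∀ T x y, ⟪x, Φ T y⟫_ℂ = ⟪W x, π T (W y)⟫_ℂ) : IsCompletelyPositive Φ := by
  refine ⟨⟨Φ, fun k M hM => ?_⟩, rfl⟩
  refine nonneg_of_sum_inner_matAct_nonneg ?_ fun f => ?_
  · ext i j : 1
    have hM' : star (M j i) = M i j := by
      have := (IsSelfAdjoint.of_nonneg hM).star_eq
      conv_rhs => rw [← this]
      exact (CStarMatrix.star_apply ..).symm
    rw [CStarMatrix.star_apply, CStarMatrix.map_apply, CStarMatrix.map_apply, ← hM']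
    refine ContinuousLinearMap.ext fun y => ext_inner_left ℂ fun x => ?_
    rw [ContinuousLinearMap.star_eq_adjoint, ContinuousLinearMap.adjoint_inner_right, hΦ,
      ← inner_conj_symm, hΦ, inner_conj_symm, map_star, ContinuousLinearMap.star_eq_adjoint,
      ContinuousLinearMap.adjoint_inner_right]
  · have := sum_inner_matAct_nonneg (H := L) (M := M.map π)
      (CompletelyPositiveMapClass.map_cstarMatrix_nonneg' π k M hM) (fun i => W (f i))
    convert this using 2 with i
    simp only [matAct, inner_sum, CStarMatrix.map_apply]
    exact Finset.sum_congr rfl fun j _ => hΦ (M i j) (f i) (f j)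

theorem IsCompletelyPositive.monotone {Φ : (K →L[ℂ] K) →ₗ[ℂ] (H →L[ℂ] H)}
    (hΦ : IsCompletelyPositive Φ) : Monotone Φ := by
  obtain ⟨Ψ, rfl⟩ := hΦ
  intro S T h
  exact OrderHomClass.mono (F := CompletelyPositiveMap (K →L[ℂ] K) (H →L[ℂ] H)) Ψ h

theorem IsCompletelyPositive.sum_inner_nonneg {Φ : (K →L[ℂ] K) →ₗ[ℂ] (H →L[ℂ] H)}
    (hΦ : IsCompletelyPositive Φ) {N : CStarMatrix n n (K →L[ℂ] K)} (f : n → H) :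
    0 ≤ ∑ i, ∑ j, ⟪f i, Φ ((star N * N) i j) (f j)⟫_ℂ := by
  obtain ⟨Ψ, rfl⟩ := hΦ
  have := sum_inner_matAct_nonneg (Ψ.map_cstarMatrix_nonneg _ (star_mul_self_nonneg N)) f
  simp only [matAct, inner_sum, CStarMatrix.map_apply] at this
  exact this

end CompletelyPositive

/-! ### Operators on the Hilbert space tensor product -/

section TensorOperators

variable {K K' : Type*} [NormedAddCommGroup K] [InnerProductSpace ℂ K]
  [NormedAddCommGroup K'] [InnerProductSpace ℂ K']

theorem HilbertTensor.clm_ext {F : Type*} [NormedAddCommGroup F] [NormedSpace ℂ F]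
    {A B : HilbertTensor K K' →L[ℂ] F}
    (h : ∀ x y, A ((x ⊗ₜ[ℂ] y : K ⊗[ℂ] K') : HilbertTensor K K') =
      B ((x ⊗ₜ[ℂ] y : K ⊗[ℂ] K') : HilbertTensor K K')) : A = B := by
  ext z
  induction z using UniformSpace.Completion.induction_on with
  | hp => exact isClosed_eq A.continuous B.continuous
  | ih z =>
    induction z using TensorProduct.induction_on with
    | zero => rw [UniformSpace.Completion.coe_zero, map_zero, map_zero]
    | tmul x y => exact h x y
    | add x y hx hy => rw [UniformSpace.Completion.coe_add, map_add, map_add, hx, hy]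

theorem opTensor_one_one : opTensor (1 : K →L[ℂ] K) (1 : K' →L[ℂ] K') = 1 :=
  HilbertTensor.clm_ext fun x y => by simp [opTensor_coe_tmul]

theorem opTensor_mul (S T : K →L[ℂ] K) (E F : K' →L[ℂ] K') :
    opTensor (S * T) (E * F) = opTensor S E * opTensor T F :=
  HilbertTensor.clm_ext fun x y => by simp [opTensor_coe_tmul]

theorem opTensor_add_left (S T : K →L[ℂ] K) (E : K' →L[ℂ] K') :
    opTensor (S + T) E = opTensor S E + opTensor T E :=
  HilbertTensor.clm_ext fun x y => by
    simp [opTensor_coe_tmul, TensorProduct.add_tmul, UniformSpace.Completion.coe_add]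

theorem opTensor_add_right (T : K →L[ℂ] K) (E F : K' →L[ℂ] K') :
    opTensor T (E + F) = opTensor T E + opTensor T F :=
  HilbertTensor.clm_ext fun x y => by
    simp [opTensor_coe_tmul, TensorProduct.tmul_add, UniformSpace.Completion.coe_add]

theorem opTensor_smul_left (c : ℂ) (T : K →L[ℂ] K) (E : K' →L[ℂ] K') :
    opTensor (c • T) E = c • opTensor T E :=
  HilbertTensor.clm_ext fun x y => by
    rw [smul_apply, opTensor_coe_tmul, opTensor_coe_tmul,
      smul_apply, ← TensorProduct.smul_tmul', UniformSpace.Completion.coe_smul]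

theorem norm_opTensor_le (T : K →L[ℂ] K) (E : K' →L[ℂ] K') :
    ‖opTensor T E‖ ≤ ‖T‖ * ‖E‖ := by
  refine ContinuousLinearMap.opNorm_le_bound _ (by positivity) fun z => ?_
  induction z using UniformSpace.Completion.induction_on with
  | hp => exact isClosed_le (by fun_prop) (by fun_prop)
  | ih z =>
    rw [opTensor, ContinuousLinearMap.completion_apply_coe, UniformSpace.Completion.norm_coe,
      UniformSpace.Completion.norm_coe]
    exact (TensorProduct.mapL T E).le_of_opNorm_le (TensorProduct.norm_mapL_le T E) z

/-- Clear on algebraic tensors by linearity; the eventual norm bound extends it to the completion.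
-/
theorem tendsto_opTensor_apply {α : Type*} {l : Filter α} {A : α → K →L[ℂ] K} {T : K →L[ℂ] K}
    {M : ℝ} (hM : ∀ᶠ a in l, ‖A a‖ ≤ M) (hA : ∀ x, Tendsto (fun a => A a x) l (𝓝 (T x)))
    (E : K' →L[ℂ] K') (z : HilbertTensor K K') :
    Tendsto (fun a => opTensor (A a) E z) l (𝓝 (opTensor T E z)) := by
  have halg : ∀ w : K ⊗[ℂ] K', Tendsto (fun a => opTensor (A a) E (w : HilbertTensor K K')) l
      (𝓝 (opTensor T E (w : HilbertTensor K K'))) := by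
    intro w
    induction w using TensorProduct.induction_on with
    | zero => simp only [UniformSpace.Completion.coe_zero, map_zero, tendsto_const_nhds]
    | tmul x y =>
      simp only [opTensor_coe_tmul]
      exact ((UniformSpace.Completion.continuous_coe _).comp
        ((TensorProduct.continuous_tmul ..).comp
          (Continuous.prodMk_left (E y)))).continuousAt.tendsto.comp (hA x)
    | add x y hx hy =>
      simp only [UniformSpace.Completion.coe_add, map_add]
      exact hx.add hy
  rw [Metric.tendsto_nhds]
  intro ε hε
  -- Dominates the sum of the Lipschitz constants of both operators, so replacing `z` by `w` costs
  -- less than `ε / 2` in total.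
  set C := |M| * ‖E‖ + ‖opTensor T E‖ + 1 with hC
  have hC0 : 0 < C := by positivity
  obtain ⟨w, hw⟩ := UniformSpace.Completion.denseRange_coe.exists_dist_lt z
    (show 0 < ε / 2 / C by positivity)
  filter_upwards [hM, Metric.tendsto_nhds.1 (halg w) (ε / 2) (by positivity)] with a ha1 ha2
  have h1 : dist (opTensor (A a) E z) (opTensor (A a) E w) ≤ |M| * ‖E‖ * dist z w := by
    rw [dist_eq_norm, dist_eq_norm, ← map_sub]
    refine (opTensor (A a) E).le_of_opNorm_le ((norm_opTensor_le _ _).trans ?_) _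
    gcongr
    exact ha1.trans (le_abs_self M)
  have h2 : dist (opTensor T E z) (opTensor T E w) ≤ ‖opTensor T E‖ * dist z w := by
    rw [dist_eq_norm, dist_eq_norm, ← map_sub]
    exact (opTensor T E).le_opNorm _
  have h3 : C * dist z w < ε / 2 := by
    rw [lt_div_iff₀ hC0] at hw; linarith
  have h4 := dist_nonneg (x := z) (y := (w : HilbertTensor K K'))
  calc dist (opTensor (A a) E z) (opTensor T E z)
      ≤ dist (opTensor (A a) E z) (opTensor (A a) E w) + dist (opTensor (A a) E w) (opTensor T E w)
        + dist (opTensor T E w) (opTensor T E z) := dist_triangle4 _ _ _ _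
    _ < ε := by rw [dist_comm (opTensor T E w)]; nlinarith

theorem inner_coe_tmul (x x' : K) (y y' : K') :
    ⟪((x ⊗ₜ[ℂ] y : K ⊗[ℂ] K') : HilbertTensor K K'),
      ((x' ⊗ₜ[ℂ] y' : K ⊗[ℂ] K') : HilbertTensor K K')⟫_ℂ = ⟪x, x'⟫_ℂ * ⟪y, y'⟫_ℂ := by
  rw [UniformSpace.Completion.inner_coe, TensorProduct.inner_tmul]

/-- The isometry `x ↦ e ⊗ x` defined by a unit vector `e`. -/
noncomputable def unitTensor (e : K) (he : ‖e‖ = 1) : K' →ₗᵢ[ℂ] HilbertTensor K K' where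
  toFun x := ((e ⊗ₜ[ℂ] x : K ⊗[ℂ] K') : HilbertTensor K K')
  map_add' x y := by rw [TensorProduct.tmul_add, UniformSpace.Completion.coe_add]
  map_smul' c x := by
    rw [TensorProduct.tmul_smul, UniformSpace.Completion.coe_smul, RingHom.id_apply]
  norm_map' x := by
    rw [LinearMap.coe_mk, AddHom.coe_mk, UniformSpace.Completion.norm_coe,
      TensorProduct.norm_tmul, he, one_mul]

theorem unitTensor_apply (e : K) (he : ‖e‖ = 1) (x : K') : unitTensor e he x =
    ((e ⊗ₜ[ℂ] x : K ⊗[ℂ] K') : HilbertTensor K K') := rfl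

variable [CompleteSpace K] [CompleteSpace K']

theorem star_opTensor (T : K →L[ℂ] K) (E : K' →L[ℂ] K') :
    star (opTensor T E) = opTensor (star T) (star E) := by
  symm
  refine (ContinuousLinearMap.eq_adjoint_iff _ _).2 fun z w => ?_
  induction z, w using UniformSpace.Completion.induction_on₂ with
  | hp => exact isClosed_eq (by fun_prop) (by fun_prop)
  | ih z w =>
    induction z using TensorProduct.induction_on with
    | zero => simp only [UniformSpace.Completion.coe_zero, map_zero, inner_zero_left]
    | add x y hx hy => simp only [UniformSpace.Completion.coe_add, map_add, inner_add_left, hx, hy]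
    | tmul x y =>
      induction w using TensorProduct.induction_on with
      | zero => simp only [UniformSpace.Completion.coe_zero, map_zero, inner_zero_right]
      | add x y hx hy =>
        simp only [UniformSpace.Completion.coe_add, map_add, inner_add_right, hx, hy]
      | tmul x' y' =>
        rw [opTensor_coe_tmul, opTensor_coe_tmul, inner_coe_tmul, inner_coe_tmul,
          ContinuousLinearMap.star_eq_adjoint, ContinuousLinearMap.star_eq_adjoint,
          ContinuousLinearMap.adjoint_inner_left, ContinuousLinearMap.adjoint_inner_left]

variable (K K') in
/-- The representation `T ↦ T ⊗ 1` of `𝓛(K)`. -/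
noncomputable def amplification :
    (K →L[ℂ] K) →⋆ₐ[ℂ] (HilbertTensor K K' →L[ℂ] HilbertTensor K K') where
  toFun T := opTensor T 1
  map_one' := opTensor_one_one
  map_mul' S T := by rw [← opTensor_mul, one_mul]
  map_zero' := by simpa using opTensor_smul_left (0 : ℂ) (0 : K →L[ℂ] K) (1 : K' →L[ℂ] K')
  map_add' S T := opTensor_add_left S T 1
  commutes' c := by
    rw [Algebra.algebraMap_eq_smul_one, opTensor_smul_left, opTensor_one_one,
      Algebra.algebraMap_eq_smul_one]
  map_star' T := by rw [star_opTensor, star_one]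

theorem opTensor_star_mul_self (T : K →L[ℂ] K) (R : K' →L[ℂ] K') :
    opTensor T (star R * R) = star (opTensor 1 R) * opTensor T 1 * opTensor 1 R := by
  rw [star_opTensor, ← opTensor_mul, ← opTensor_mul]
  simp

theorem opTensor_nonneg {E : K' →L[ℂ] K'} (hE : 0 ≤ E) : 0 ≤ opTensor (1 : K →L[ℂ] K) E := by
  obtain ⟨R, rfl⟩ := exists_eq_star_mul_self_of_nonneg hE
  rw [opTensor_star_mul_self, opTensor_one_one, mul_one]
  exact star_mul_self_nonneg (opTensor (1 : K →L[ℂ] K) R)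

end TensorOperators

/-! ### Operations and instruments from effects on an ancilla -/

section Dilate

variable {H K K' : Type*}
  [NormedAddCommGroup H] [InnerProductSpace ℂ H] [CompleteSpace H]
  [NormedAddCommGroup K] [InnerProductSpace ℂ K]
  [NormedAddCommGroup K'] [InnerProductSpace ℂ K']

/-- The map `T ↦ V* (T ⊗ E) V`. -/
noncomputable def dilate (V : H →ₗᵢ[ℂ] HilbertTensor K K') (E : K' →L[ℂ] K') :
    (K →L[ℂ] K) →ₗ[ℂ] (H →L[ℂ] H) where
  toFun T := V.toContinuousLinearMap.adjoint ∘L opTensor T E ∘L V.toContinuousLinearMap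
  map_add' S T := by
    rw [opTensor_add_left, ContinuousLinearMap.add_comp, ContinuousLinearMap.comp_add]
  map_smul' c T := by
    rw [opTensor_smul_left, ContinuousLinearMap.smul_comp, ContinuousLinearMap.comp_smul,
      RingHom.id_apply]

variable (V : H →ₗᵢ[ℂ] HilbertTensor K K')

theorem dilate_apply (E : K' →L[ℂ] K') (T : K →L[ℂ] K) :
    dilate V E T = V.toContinuousLinearMap.adjoint ∘L opTensor T E ∘L V.toContinuousLinearMap :=
  rfl

theorem inner_dilate (E : K' →L[ℂ] K') (T : K →L[ℂ] K) (x y : H) :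
    ⟪x, dilate V E T y⟫_ℂ = ⟪V x, opTensor T E (V y)⟫_ℂ := by
  rw [dilate_apply, ContinuousLinearMap.comp_apply, ContinuousLinearMap.adjoint_inner_right]
  rfl

theorem dilate_one_one : dilate V 1 1 = 1 := by
  refine ContinuousLinearMap.ext fun y => ext_inner_left ℂ fun x => ?_
  rw [inner_dilate, opTensor_one_one]
  exact V.inner_map_map x y

theorem dilate_add (E F : K' →L[ℂ] K') : dilate V (E + F) = dilate V E + dilate V F := by
  refine LinearMap.ext fun T => ContinuousLinearMap.ext fun y => ext_inner_left ℂ fun x => ?_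
  simp only [LinearMap.add_apply, add_apply, inner_add_right, inner_dilate, opTensor_add_right]

theorem dilate_sum {Ω : Type*} (X : Finset Ω) (G : Ω → K' →L[ℂ] K') :
    dilate V (∑ x ∈ X, G x) = ∑ x ∈ X, dilate V (G x) := by
  have h0 : dilate V 0 = 0 := by simpa using dilate_add V 0 0
  exact map_sum (AddMonoidHom.mk ⟨dilate V, h0⟩ (dilate_add V)) G X

theorem dilate_unitTensor [CompleteSpace K'] (e : K) (he : ‖e‖ = 1) (E : K' →L[ℂ] K') :
    dilate (unitTensor e he) E 1 = E := by
  refine ContinuousLinearMap.ext fun y => ext_inner_left ℂ fun x => ?_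
  rw [inner_dilate, unitTensor_apply, unitTensor_apply, opTensor_coe_tmul, inner_coe_tmul,
    one_apply_eq_self, inner_self_eq_norm_sq_to_K, he]
  simp

variable [CompleteSpace K] [CompleteSpace K']

theorem isCompletelyPositive_dilate {E : K' →L[ℂ] K'} (hE : 0 ≤ E) :
    IsCompletelyPositive (dilate V E) := by
  obtain ⟨R, rfl⟩ := exists_eq_star_mul_self_of_nonneg hE
  refine isCompletelyPositive_of_dilation (amplification K K')
    (opTensor 1 R ∘L V.toContinuousLinearMap) _ fun T x y => ?_
  rw [inner_dilate, opTensor_star_mul_self, ContinuousLinearMap.star_eq_adjoint, mul_assoc,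
    mul_apply_eq_comp, ContinuousLinearMap.adjoint_inner_right]
  rfl

theorem isNormalMap_dilate {E : K' →L[ℂ] K'} (hE : 0 ≤ E) : IsNormalMap (dilate V E) := by
  refine isNormalMap_of_tendsto (isCompletelyPositive_dilate V hE).monotone
    fun S T M hM hS x => ?_
  simp only [inner_dilate]
  exact tendsto_const_nhds.inner (tendsto_opTensor_apply hM hS E (V x))

theorem dilate_mono {E F : K' →L[ℂ] K'} (h : E ≤ F) : dilate V E 1 ≤ dilate V F 1 := by
  refine le_iff_forall_inner.2 fun x => ?_
  have h1 := nonneg_iff_forall_inner.1 (opTensor_nonneg (K := K) (sub_nonneg.2 h)) (V x)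
  have h2 : opTensor (1 : K →L[ℂ] K) F = opTensor 1 (F - E) + opTensor 1 E := by
    rw [← opTensor_add_right, sub_add_cancel]
  rw [inner_dilate, inner_dilate, h2, add_apply, inner_add_right]
  exact le_add_of_nonneg_left h1

theorem isOperation_dilate {E : K' →L[ℂ] K'} (hE : IsEffect E) : IsOperation (dilate V E) where
  completelyPositive := isCompletelyPositive_dilate V hE.1
  normal := isNormalMap_dilate V hE.1
  map_one_le := (dilate_mono V hE.2).trans_eq (dilate_one_one V)

theorem isEffect_one : IsEffect (1 : K' →L[ℂ] K') := ⟨zero_le_one, le_rfl⟩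

theorem isEffect_of_sum_eq_one {Ω : Type*} [Fintype Ω] {G : Ω → K' →L[ℂ] K'}
    (hG : ∀ x, 0 ≤ G x) (hsum : ∑ x, G x = 1) (X : Finset Ω) : IsEffect (∑ x ∈ X, G x) :=
  ⟨Finset.sum_nonneg fun x _ => hG x,
    (Finset.sum_le_univ_sum_of_nonneg hG).trans_eq hsum⟩

/-- The total channel is `dilate V 1`, whatever the POVM `G`. -/
theorem isInstrument_dilate {Ω : Type} [Fintype Ω] {G : Ω → K' →L[ℂ] K'}
    (hG : ∀ x, 0 ≤ G x) (hsum : ∑ x, G x = 1) : IsInstrument fun x => dilate V (G x) where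
  operation x := isOperation_dilate V (by simpa using isEffect_of_sum_eq_one hG hsum {x})
  channel := by
    rw [← dilate_sum, hsum]
    exact ⟨isOperation_dilate V isEffect_one, dilate_one_one V⟩

/-- The two-outcome instrument `E, 1 - E` defined by an effect. -/
theorem isInstrument_dilate_effect {E : K' →L[ℂ] K'} (hE : IsEffect E) :
    IsInstrument (fun x : Bool => dilate V (bif x then E else 1 - E)) ∧
      OperationIsPartOf (dilate V E) (fun x : Bool => dilate V (bif x then E else 1 - E)) ∧
      ∑ x : Bool, dilate V (bif x then E else 1 - E) = dilate V 1 := by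
  have hsum : ∑ x : Bool, (bif x then E else 1 - E) = 1 := by simp
  refine ⟨isInstrument_dilate V ?_ hsum, ⟨{true}, by simp⟩, by rw [← dilate_sum, hsum]⟩
  rintro (_ | _)
  · exact sub_nonneg.2 hE.2
  · exact hE.1

end Dilate

/-! ### Compatible effects and POVMs -/

section Effects

variable {L : Type u} [NormedAddCommGroup L] [InnerProductSpace ℂ L] [CompleteSpace L]

theorem IsInstrument.effects {H K : Type*}
    [NormedAddCommGroup H] [InnerProductSpace ℂ H] [CompleteSpace H]
    [NormedAddCommGroup K] [InnerProductSpace ℂ K] [CompleteSpace K] {Ω : Type} [Fintype Ω]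
    {I : Ω → (K →L[ℂ] K) →ₗ[ℂ] (H →L[ℂ] H)} (hI : IsInstrument I) :
    (∀ x, 0 ≤ I x 1) ∧ ∑ x, I x 1 = 1 := by
  refine ⟨fun x => ?_, by simpa using hI.channel.map_one⟩
  simpa using (hI.operation x).completelyPositive.monotone (zero_le_one (α := K →L[ℂ] K))

theorem effectsCompatible_of_sum_eq_one {Ω : Type} [Fintype Ω] {G : Ω → L →L[ℂ] L}
    (hG : ∀ x, 0 ≤ G x) (hsum : ∑ x, G x = 1) (X Y : Finset Ω) :
    EffectsCompatible (∑ x ∈ X, G x) (∑ x ∈ Y, G x) := by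
  -- A one-dimensional output space suffices, since only the values at `1` matter; `PUnit.{u + 1}`
  -- puts it in the required universe.
  let e : EuclideanSpace ℂ PUnit.{u + 1} := EuclideanSpace.single PUnit.unit 1
  have he : ‖e‖ = 1 := by simp [e]
  have hpart : ∀ Z : Finset Ω, ∑ x ∈ Z, G x = (∑ x ∈ Z, dilate (unitTensor e he) (G x)) 1 := by
    intro Z
    rw [← dilate_sum, dilate_unitTensor]
  exact ⟨EuclideanSpace ℂ PUnit.{u + 1}, inferInstance, inferInstance, inferInstance,
    inferInstance, Ω, inferInstance, _, isInstrument_dilate (unitTensor e he) hG hsum,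
    ⟨X, hpart X⟩, ⟨Y, hpart Y⟩⟩

end Effects

/-! ### Weak limits of compressions under normal maps -/

section WeakContinuity

variable {H K : Type*}
  [NormedAddCommGroup H] [InnerProductSpace ℂ H] [CompleteSpace H]
  [NormedAddCommGroup K] [InnerProductSpace ℂ K] [CompleteSpace K]

/-- The vector functional `T ↦ ⟪x, Φ T x⟫` of a positive map. -/
noncomputable def vectorFunctional {Φ : (K →L[ℂ] K) →ₗ[ℂ] (H →L[ℂ] H)} (hΦ : Monotone Φ) (x : H) :
    (K →L[ℂ] K) →ₚ[ℂ] ℂ :=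
  PositiveLinearMap.mk₀
    { toFun := fun T => ⟪x, Φ T x⟫_ℂ
      map_add' := fun S T => by rw [map_add, add_apply, inner_add_right]
      map_smul' := fun c T => by rw [map_smul, smul_apply, inner_smul_right]; rfl }
    fun T hT => by
      have h := hΦ hT
      rw [map_zero] at h
      exact nonneg_iff_forall_inner.1 h x

theorem map_star_of_monotone {Φ : (K →L[ℂ] K) →ₗ[ℂ] (H →L[ℂ] H)} (hΦ : Monotone Φ)
    (T : K →L[ℂ] K) : Φ (star T) = star (Φ T) :=
  map_star (PositiveLinearMap.mk₀ Φ fun T hT => by simpa using hΦ hT) T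

/-- The Cauchy--Schwarz inequality for positive functionals. -/
theorem norm_apply_star_mul_le {A : Type*} [NonUnitalCStarAlgebra A] [PartialOrder A]
    [StarOrderedRing A] (φ : A →ₚ[ℂ] ℂ) (a b : A) :
    ‖φ (star a * b)‖ ≤ √(φ (star a * a)).re * √(φ (star b * b)).re :=
  norm_inner_le_norm (𝕜 := ℂ) (φ.toPreGNS a) (φ.toPreGNS b)

variable {ι : Type*} (b : HilbertBasis ι ℂ K)

theorem norm_basisProj_le (s : Finset ι) : ‖basisProj b s‖ ≤ 1 := by
  have h0 : 0 ≤ basisProj b s := by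
    simpa [basisProj] using basisProj_mono b (Finset.empty_subset s)
  refine (CStarAlgebra.norm_le_norm_of_nonneg_of_le h0 (basisProj_le_one b s)).trans ?_
  exact ContinuousLinearMap.norm_id_le

/-- The compressions need not be monotone, so normality is used only for `φ (1 - P) → 0`.
Cauchy–Schwarz bounds both terms of `T - P T P = (1 - P) T + P T (1 - P)` by a constant times `√φ (1
- P)`. -/
theorem tendsto_compression {Φ : (K →L[ℂ] K) →ₗ[ℂ] (H →L[ℂ] H)} (hΦ : IsNormalMap Φ)
    (hmono : Monotone Φ) (T : K →L[ℂ] K) (x : H) :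
    Tendsto (fun s => ⟪x, Φ (basisProj b s * T * basisProj b s) x⟫_ℂ) atTop
      (𝓝 ⟪x, Φ T x⟫_ℂ) := by
  set φ := vectorFunctional hmono x
  have hlim : Tendsto (fun s => (φ (1 - basisProj b s)).re) atTop (𝓝 0) := by
    have h1 := hΦ.tendsto_basisProj b hmono x
    have h2 : Tendsto (fun s => (φ 1 - φ (basisProj b s)).re) atTop (𝓝 (φ 1 - φ 1).re) :=
      (Complex.continuous_re.tendsto _).comp (tendsto_const_nhds.sub h1)
    simpa using h2
  obtain ⟨C, hC⟩ := φ.exists_norm_apply_le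
  have hQ : ∀ s, star (1 - basisProj b s) * (1 - basisProj b s) = 1 - basisProj b s := by
    intro s
    rw [star_sub, star_one, (basisProj_isSelfAdjoint b s).star_eq, sub_mul, mul_sub, mul_sub,
      basisProj_mul_self]
    simp
  have hb1 : ∀ s, ‖φ ((1 - basisProj b s) * T)‖ ≤
      √(φ (1 - basisProj b s)).re * √(φ (star T * T)).re := by
    intro s
    have h := norm_apply_star_mul_le φ (1 - basisProj b s) T
    rwa [hQ, star_sub, star_one, (basisProj_isSelfAdjoint b s).star_eq] at h
  have hb2 : ∀ s, ‖φ (basisProj b s * T * (1 - basisProj b s))‖ ≤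
      √(C * ‖T‖ ^ 2) * √(φ (1 - basisProj b s)).re := by
    intro s
    have h := norm_apply_star_mul_le φ (star (basisProj b s * T)) (1 - basisProj b s)
    rw [hQ, star_star] at h
    refine h.trans ?_
    gcongr
    refine (Complex.re_le_norm _).trans ((hC _).trans ?_)
    gcongr
    rw [CStarRing.norm_self_mul_star, ← sq]
    gcongr
    refine (norm_mul_le _ _).trans ?_
    exact mul_le_of_le_one_left (norm_nonneg _) (norm_basisProj_le b s)
  have hsqrt : Tendsto (fun s => √(φ (1 - basisProj b s)).re) atTop (𝓝 0) := by
    have h := (Real.continuous_sqrt.tendsto 0).comp hlim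
    rwa [Real.sqrt_zero] at h
  have hbound : Tendsto (fun s => √(φ (1 - basisProj b s)).re * √(φ (star T * T)).re +
      √(C * ‖T‖ ^ 2) * √(φ (1 - basisProj b s)).re) atTop (𝓝 0) := by
    have h := (hsqrt.mul_const √(φ (star T * T)).re).add (hsqrt.const_mul √(C * ‖T‖ ^ 2))
    rwa [zero_mul, mul_zero, add_zero] at h
  rw [tendsto_iff_norm_sub_tendsto_zero]
  refine squeeze_zero (fun _ => norm_nonneg _) (fun s => ?_) hbound
  rw [norm_sub_rev]
  have hsplit : φ T - φ (basisProj b s * T * basisProj b s) =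
      φ ((1 - basisProj b s) * T) + φ (basisProj b s * T * (1 - basisProj b s)) := by
    rw [← map_sub, ← map_add]
    congr 1
    noncomm_ring
  exact (congrArg norm hsplit).le.trans ((norm_add_le _ _).trans (add_le_add (hb1 s) (hb2 s)))

end WeakContinuity

/-! ### The Hilbert space of a semidefinite form -/

section GNS

universe w

/-- The Hilbert space of a positive semidefinite sesquilinear form. -/
theorem exists_hilbertSpace_of_form {X : Type w} [AddCommGroup X] [Module ℂ X] (s : X → X → ℂ)
    (hsymm : ∀ f g, starRingEnd ℂ (s g f) = s f g) (hpos : ∀ f, 0 ≤ s f f)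
    (hadd : ∀ f g h, s (f + g) h = s f h + s g h)
    (hsmul : ∀ f g (c : ℂ), s (c • f) g = starRingEnd ℂ c * s f g) :
    ∃ (K' : Type w) (_ : NormedAddCommGroup K') (_ : InnerProductSpace ℂ K')
      (_ : CompleteSpace K') (q : X →ₗ[ℂ] K'),
      DenseRange q ∧ ∀ f g, ⟪q f, q g⟫_ℂ = s f g := by
  let c : PreInnerProductSpace.Core ℂ X :=
    { inner := s
      conj_inner_symm := hsymm
      re_inner_nonneg := fun f => (Complex.nonneg_iff.1 (hpos f)).1
      add_left := hadd
      smul_left := hsmul }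
  let _ : SeminormedAddCommGroup X := InnerProductSpace.Core.toSeminormedAddCommGroup (c := c)
  let _ : InnerProductSpace ℂ X := InnerProductSpace.ofCore c
  -- No prior quotient by null vectors: the completion is Hausdorff and identifies them with zero.
  refine ⟨UniformSpace.Completion X, inferInstance, inferInstance, inferInstance,
    (UniformSpace.Completion.toComplL (𝕜 := ℂ) (E := X)).toLinearMap,
    UniformSpace.Completion.denseRange_coe, fun f g => ?_⟩
  exact UniformSpace.Completion.inner_coe f g

end GNS

/-! ### The Choi form -/

section ChoiForm

variable {H K : Type*}
  [NormedAddCommGroup H] [InnerProductSpace ℂ H]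
  [NormedAddCommGroup K] [InnerProductSpace ℂ K]
  {ι : Type*} (b : HilbertBasis ι ℂ K)

/-- The sesquilinear form `∑ i j, ⟪f i, Φ(|b i⟩⟨b j|) g j⟫` of the Choi matrix of `Φ`. -/
noncomputable def choiForm (Φ : (K →L[ℂ] K) →ₗ[ℂ] (H →L[ℂ] H)) (f g : ι →₀ H) : ℂ :=
  f.sum fun i x => g.sum fun j y => ⟪x, Φ (InnerProductSpace.rankOne ℂ (b i) (b j)) y⟫_ℂ

theorem choiForm_single (Φ : (K →L[ℂ] K) →ₗ[ℂ] (H →L[ℂ] H)) (i j : ι) (x y : H) :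
    choiForm b Φ (Finsupp.single i x) (Finsupp.single j y) =
      ⟪x, Φ (InnerProductSpace.rankOne ℂ (b i) (b j)) y⟫_ℂ := by
  rw [choiForm, Finsupp.sum_single_index, Finsupp.sum_single_index] <;> simp

theorem choiForm_add_left (Φ : (K →L[ℂ] K) →ₗ[ℂ] (H →L[ℂ] H)) (f g h : ι →₀ H) :
    choiForm b Φ (f + g) h = choiForm b Φ f h + choiForm b Φ g h := by
  classical
  refine Finsupp.sum_add_index' (fun i => by simp) fun i x y => ?_
  simp only [inner_add_left]
  exact Finsupp.sum_add

theorem choiForm_smul_left (Φ : (K →L[ℂ] K) →ₗ[ℂ] (H →L[ℂ] H)) (f g : ι →₀ H) (c : ℂ) :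
    choiForm b Φ (c • f) g = starRingEnd ℂ c * choiForm b Φ f g := by
  rw [choiForm, Finsupp.sum_smul_index' (fun i => by simp), choiForm]
  simp only [Finsupp.sum, inner_smul_left, Finset.mul_sum]

theorem choiForm_sum {Ω : Type*} [Fintype Ω] (I : Ω → (K →L[ℂ] K) →ₗ[ℂ] (H →L[ℂ] H))
    (f g : ι →₀ H) : choiForm b (∑ x, I x) f g = ∑ x, choiForm b (I x) f g := by
  simp only [choiForm, Finsupp.sum, LinearMap.sum_apply, sum_apply, inner_sum]
  rw [Finset.sum_comm (s := Finset.univ)]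
  exact Finset.sum_congr rfl fun i _ => Finset.sum_comm

variable [CompleteSpace H] [CompleteSpace K]

theorem choiForm_conj_symm {Φ : (K →L[ℂ] K) →ₗ[ℂ] (H →L[ℂ] H)} (hΦ : Monotone Φ)
    (f g : ι →₀ H) : starRingEnd ℂ (choiForm b Φ g f) = choiForm b Φ f g := by
  have hstar : ∀ i j, Φ (InnerProductSpace.rankOne ℂ (b j) (b i)) =
      star (Φ (InnerProductSpace.rankOne ℂ (b i) (b j))) := by
    intro i j
    rw [← map_star_of_monotone hΦ, ContinuousLinearMap.star_eq_adjoint,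
      InnerProductSpace.adjoint_rankOne]
  simp only [choiForm, Finsupp.sum, map_sum, inner_conj_symm]
  rw [Finset.sum_comm]
  refine Finset.sum_congr rfl fun i _ => Finset.sum_congr rfl fun j _ => ?_
  rw [hstar, ContinuousLinearMap.star_eq_adjoint, ContinuousLinearMap.adjoint_inner_left]

theorem choiForm_nonneg {Φ : (K →L[ℂ] K) →ₗ[ℂ] (H →L[ℂ] H)} (hΦ : IsCompletelyPositive Φ)
    (f : ι →₀ H) : 0 ≤ choiForm b Φ f f := by
  classical
  rcases f.support.eq_empty_or_nonempty with h0 | ⟨i₀, hi₀⟩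
  · simp [choiForm, Finsupp.sum, h0]
  -- A single nonzero row `|b i₀⟩⟨b j|` makes `N* N` the matrix of units `|b i⟩⟨b j|`. As `N` is
  -- square, the row label must lie in the support, whence the separate empty case.
  let N : CStarMatrix f.support f.support (K →L[ℂ] K) := fun k j =>
    if k = ⟨i₀, hi₀⟩ then InnerProductSpace.rankOne ℂ (b i₀) (b j) else 0
  have hN : ∀ i j, (star N * N) i j = InnerProductSpace.rankOne ℂ (b i) (b j) := by
    intro i j
    rw [CStarMatrix.mul_apply, Finset.sum_eq_single ⟨i₀, hi₀⟩]
    · have h0 : ∀ j, N ⟨i₀, hi₀⟩ j = InnerProductSpace.rankOne ℂ (b i₀) (b j) := fun j => if_pos rfl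
      rw [CStarMatrix.star_apply, h0, h0, ContinuousLinearMap.star_eq_adjoint,
        InnerProductSpace.adjoint_rankOne]
      ext y
      simp [b.orthonormal.1 i₀, inner_self_eq_norm_sq_to_K]
    · intro k _ hk
      simp [N, hk]
    · simp
  have h := hΦ.sum_inner_nonneg (N := N) fun i => f i
  simp only [hN] at h
  rw [choiForm, Finsupp.sum, ← Finset.sum_coe_sort]
  simp only [Finsupp.sum]
  convert h using 2 with i
  exact (Finset.sum_coe_sort f.support fun j =>
    ⟪f i, Φ (InnerProductSpace.rankOne ℂ (b i) (b j)) (f j)⟫_ℂ).symm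

end ChoiForm

/-! ### Separability of the ancilla -/

section Separability

variable {K : Type*} [NormedAddCommGroup K] [InnerProductSpace ℂ K] [SeparableSpace K]
  {ι : Type*}

theorem countable_of_orthonormal {e : ι → K} (he : Orthonormal ℂ e) : Countable ι := by
  refine Pairwise.countable_of_isOpen_disjoint (s := fun i => Metric.ball (e i) (1 / 2)) ?_
    (fun i => Metric.isOpen_ball) (fun i => ⟨e i, Metric.mem_ball_self (by norm_num)⟩)
  intro i j hij
  refine Metric.ball_disjoint_ball ?_
  have h : ‖e i - e j‖ ^ 2 = 2 := by
    rw [@norm_sub_sq ℂ, he.2 hij, he.1, he.1]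
    norm_num
  rw [dist_eq_norm]
  nlinarith [norm_nonneg (e i - e j)]

theorem separableSpace_of_denseRange_finsupp {H F : Type*} [NormedAddCommGroup H] [NormedSpace ℂ H]
    [SeparableSpace H] [NormedAddCommGroup F] [NormedSpace ℂ F] [Countable ι]
    {q : (ι →₀ H) →ₗ[ℂ] F} (hq : DenseRange q)
    (hcont : ∀ i, Continuous fun x => q (Finsupp.single i x)) : SeparableSpace F := by
  have h1 : IsSeparable (⋃ i, Set.range fun x => q (Finsupp.single i x)) :=
    IsSeparable.iUnion fun i => isSeparable_range (hcont i)
  have h2 := (h1.span (R := ℂ)).closure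
  refine isSeparable_univ_iff.1 (h2.mono ?_)
  intro z _
  refine closure_mono ?_ (hq z)
  rintro _ ⟨f, rfl⟩
  induction f using Finsupp.induction_linear with
  | zero => simp
  | add f g hf hg => rw [map_add]; exact add_mem hf hg
  | single i x => exact Submodule.subset_span (Set.mem_iUnion.2 ⟨i, x, rfl⟩)

end Separability

/-! ### The isometry and the Radon–Nikodym derivative -/

section Dilation

variable {H K K' : Type*}
  [NormedAddCommGroup H] [InnerProductSpace ℂ H] [CompleteSpace H]
  [NormedAddCommGroup K] [InnerProductSpace ℂ K] [CompleteSpace K]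
  [NormedAddCommGroup K'] [InnerProductSpace ℂ K']
  {ι : Type*} (b : HilbertBasis ι ℂ K)

/-- On the partial sum of `v` over `s`, the left side expands to `⟪x, Φ (P T P) x⟫` with `P =
basisProj b s`; both sides then converge. -/
theorem inner_opTensor_of_hasSum {Φ : (K →L[ℂ] K) →ₗ[ℂ] (H →L[ℂ] H)} (hΦ : IsOperation Φ)
    {q : (ι →₀ H) →ₗ[ℂ] K'} {G : K' →L[ℂ] K'}
    (hG : ∀ f g, ⟪q f, G (q g)⟫_ℂ = choiForm b Φ f g) {x : H} {v : HilbertTensor K K'}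
    (hv : HasSum (fun i => ((b i ⊗ₜ[ℂ] q (Finsupp.single i x) : K ⊗[ℂ] K') :
      HilbertTensor K K')) v) (T : K →L[ℂ] K) :
    ⟪v, opTensor T G v⟫_ℂ = ⟪x, Φ T x⟫_ℂ := by
  have h1 := Tendsto.inner (𝕜 := ℂ) hv (((opTensor T G).continuous.tendsto v).comp hv)
  refine tendsto_nhds_unique h1
    ((tendsto_compression b hΦ.normal hΦ.completelyPositive.monotone T x).congr fun s => ?_)
  simp only [basisProj_mul_mul_basisProj, map_sum, map_smul, sum_apply, smul_apply, inner_sum,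
    inner_smul_right, Function.comp_apply, sum_inner, opTensor_coe_tmul, inner_coe_tmul, hG,
    choiForm_single]
  exact Finset.sum_comm

/-- The terms are orthogonal and their squared norms have partial sums `⟪x, Λ (basisProj b s) x⟫`,
convergent by normality. Isometry is the previous lemma with `G = 1`, `T = 1`. -/
theorem exists_isometry_hasSum {Λ : (K →L[ℂ] K) →ₗ[ℂ] (H →L[ℂ] H)} (hΛ : IsChannel Λ)
    {q : (ι →₀ H) →ₗ[ℂ] K'} [CompleteSpace K'] (hq : ∀ f g, ⟪q f, q g⟫_ℂ = choiForm b Λ f g) :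
    ∃ V : H →ₗᵢ[ℂ] HilbertTensor K K', ∀ x,
      HasSum (fun i => ((b i ⊗ₜ[ℂ] q (Finsupp.single i x) : K ⊗[ℂ] K') : HilbertTensor K K'))
        (V x) := by
  classical
  set w : ι → H →ₗ[ℂ] HilbertTensor K K' := fun i =>
    (unitTensor (b i) (b.orthonormal.1 i)).toLinearMap ∘ₗ q ∘ₗ Finsupp.lsingle i
  have hw_apply : ∀ i x, w i x =
      ((b i ⊗ₜ[ℂ] q (Finsupp.single i x) : K ⊗[ℂ] K') : HilbertTensor K K') := fun _ _ => rfl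
  have horth : OrthogonalFamily ℂ (fun _ : ι => K')
      (fun i => unitTensor (b i) (b.orthonormal.1 i)) := by
    intro i j hij x y
    rw [unitTensor_apply, unitTensor_apply, inner_coe_tmul, b.orthonormal.2 hij, zero_mul]
  have hsummable : ∀ x, Summable fun i => w i x := by
    intro x
    refine (horth.summable_iff_norm_sq_summable fun i => q (Finsupp.single i x)).2 ?_
    have h1 := hΛ.operation.normal.tendsto_basisProj b hΛ.operation.completelyPositive.monotone x
    have h2 : HasSum (fun i => ⟪q (Finsupp.single i x), q (Finsupp.single i x)⟫_ℂ)
        ⟪x, Λ 1 x⟫_ℂ := by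
      refine h1.congr fun s => ?_
      simp only [basisProj, map_sum, sum_apply, inner_sum, hq, choiForm_single]
    have h3 := (Complex.hasSum_re h2).summable
    refine h3.congr fun i => ?_
    rw [inner_self_eq_norm_sq_to_K]
    norm_cast
  let V₀ : H →ₗ[ℂ] HilbertTensor K K' :=
    { toFun := fun x => ∑' i, w i x
      map_add' := fun x y => by
        simp only [map_add]
        exact (hsummable x).tsum_add (hsummable y)
      map_smul' := fun c x => by
        simp only [map_smul, RingHom.id_apply]
        exact (hsummable x).tsum_const_smul c }
  have hV₀ : ∀ x, HasSum (fun i => w i x) (V₀ x) := fun x => (hsummable x).hasSum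
  refine ⟨⟨V₀, fun x => ?_⟩, hV₀⟩
  have h := inner_opTensor_of_hasSum b hΛ.operation (G := 1) (fun f g => by simpa using hq f g)
    (hV₀ x) 1
  rw [opTensor_one_one, hΛ.map_one, one_apply_eq_self, one_apply_eq_self,
    inner_self_eq_norm_sq_to_K, inner_self_eq_norm_sq_to_K] at h
  have h' : ‖V₀ x‖ ^ 2 = ‖x‖ ^ 2 := by exact_mod_cast h
  exact (pow_left_inj₀ (norm_nonneg _) (norm_nonneg _) two_ne_zero).1 h'

/-- The Radon--Nikodym derivative of a completely positive map that is dominated by another. -/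
theorem exists_radonNikodym [CompleteSpace K'] {Φ Λ : (K →L[ℂ] K) →ₗ[ℂ] (H →L[ℂ] H)}
    (hΦ : IsCompletelyPositive Φ) (hle : ∀ f, choiForm b Φ f f ≤ choiForm b Λ f f)
    {q : (ι →₀ H) →ₗ[ℂ] K'} (hdense : DenseRange q)
    (hq : ∀ f g, ⟪q f, q g⟫_ℂ = choiForm b Λ f g) :
    ∃ G : K' →L[ℂ] K', 0 ≤ G ∧ ∀ f g, ⟪q f, G (q g)⟫_ℂ = choiForm b Φ f g := by
  obtain ⟨L, _, _, _, p, -, hp⟩ := exists_hilbertSpace_of_form (choiForm b Φ)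
    (choiForm_conj_symm b hΦ.monotone) (choiForm_nonneg b hΦ) (choiForm_add_left b Φ)
    (choiForm_smul_left b Φ)
  have hnorm : ∀ f, ‖p f‖ ≤ 1 * ‖q f‖ := by
    intro f
    have h := hle f
    rw [← hp, ← hq, inner_self_eq_norm_sq_to_K, inner_self_eq_norm_sq_to_K] at h
    rw [one_mul]
    refine (pow_le_pow_iff_left₀ (norm_nonneg _) (norm_nonneg _) two_ne_zero).1 ?_
    exact_mod_cast h
  -- By `hnorm`, `q f ↦ p f` is a well-defined contraction on a dense subspace; the derivative is
  -- `J* J`.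
  let J : K' →L[ℂ] L := p.extendOfNorm q
  have hJ : ∀ f, J (q f) = p f := LinearMap.extendOfNorm_eq hdense ⟨1, hnorm⟩
  refine ⟨J.adjoint ∘L J, nonneg_iff_forall_inner.2 fun x => ?_, fun f g => ?_⟩
  · rw [ContinuousLinearMap.comp_apply, ContinuousLinearMap.adjoint_inner_right,
      inner_self_eq_norm_sq_to_K]
    exact pow_nonneg (Complex.zero_le_real.2 (norm_nonneg (J x))) 2
  · rw [ContinuousLinearMap.comp_apply, ContinuousLinearMap.adjoint_inner_right, hJ, hJ, hp]

end Dilation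

/-! ### One dilation for all instruments with a given total channel -/

section Stinespring

variable {H : Type u} {K : Type v}
  [NormedAddCommGroup H] [InnerProductSpace ℂ H] [CompleteSpace H] [SeparableSpace H]
  [NormedAddCommGroup K] [InnerProductSpace ℂ K] [CompleteSpace K] [SeparableSpace K]

/-- Every channel has a dilation in which each instrument with this total channel is given by a
positive operator valued measure on the ancilla. -/
theorem exists_common_dilation {Λ : (K →L[ℂ] K) →ₗ[ℂ] (H →L[ℂ] H)} (hΛ : IsChannel Λ) :
    ∃ (K' : Type (max u v)) (_ : NormedAddCommGroup K') (_ : InnerProductSpace ℂ K')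
      (_ : CompleteSpace K') (_ : SeparableSpace K') (V : H →ₗᵢ[ℂ] HilbertTensor K K'),
      ∀ (Ω : Type) [Fintype Ω] (I : Ω → (K →L[ℂ] K) →ₗ[ℂ] (H →L[ℂ] H)), IsInstrument I →
        ∑ x, I x = Λ → ∃ G : Ω → K' →L[ℂ] K',
          (∀ x, 0 ≤ G x) ∧ ∑ x, G x = 1 ∧ ∀ x, I x = dilate V (G x) := by
  obtain ⟨w, b, -⟩ := exists_hilbertBasis ℂ K
  have : Countable w := countable_of_orthonormal b.orthonormal
  have hCP := hΛ.operation.completelyPositive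
  obtain ⟨K', _, _, _, q, hdense, hq⟩ := exists_hilbertSpace_of_form (choiForm b Λ)
    (choiForm_conj_symm b hCP.monotone) (choiForm_nonneg b hCP) (choiForm_add_left b Λ)
    (choiForm_smul_left b Λ)
  have hcont : ∀ i, Continuous fun x => q (Finsupp.single i x) := by
    intro i
    set A := Λ (InnerProductSpace.rankOne ℂ (b i) (b i))
    refine AddMonoidHomClass.continuous_of_bound (q ∘ₗ Finsupp.lsingle i) (√‖A‖) fun x => ?_
    refine le_of_sq_le_sq ?_ (by positivity)
    have h1 := hq (Finsupp.single i x) (Finsupp.single i x)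
    rw [choiForm_single] at h1
    calc ‖q (Finsupp.single i x)‖ ^ 2 = ‖⟪x, A x⟫_ℂ‖ := by
          rw [← h1, inner_self_eq_norm_sq_to_K]
          simp
      _ ≤ ‖x‖ * (‖A‖ * ‖x‖) := (norm_inner_le_norm x (A x)).trans (by
          gcongr
          exact A.le_opNorm x)
      _ = (√‖A‖ * ‖x‖) ^ 2 := by rw [mul_pow, Real.sq_sqrt (norm_nonneg A)]; ring
  have : SeparableSpace K' := separableSpace_of_denseRange_finsupp hdense hcont
  obtain ⟨V, hV⟩ := exists_isometry_hasSum b hΛ hq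
  -- `K'` and `V` are fixed before the instrument is introduced, so two instruments can share them.
  refine ⟨K', _, _, ‹_›, ‹_›, V, fun Ω _ I hI hsum => ?_⟩
  have hle : ∀ x f, choiForm b (I x) f f ≤ choiForm b Λ f f := by
    intro x f
    rw [← hsum, choiForm_sum]
    exact Finset.single_le_sum
      (fun y _ => choiForm_nonneg b (hI.operation y).completelyPositive f) (Finset.mem_univ x)
  choose G hG0 hG using fun x =>
    exists_radonNikodym b (hI.operation x).completelyPositive (hle x) hdense hq
  refine ⟨G, hG0, ?_, fun x => LinearMap.ext fun T => ?_⟩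
  · refine ContinuousLinearMap.ext fun y => ?_
    refine congrFun (hdense.equalizer (∑ x, G x).continuous (1 : K' →L[ℂ] K').continuous ?_) y
    funext g
    refine hdense.eq_of_inner_right ℂ fun f => ?_
    simp only [Function.comp_apply, sum_apply, one_apply_eq_self, inner_sum, hG, hq]
    rw [← hsum, choiForm_sum]
  -- Over `ℂ` an operator is determined by its quadratic form, so the diagonal identity suffices.
  · refine ContinuousLinearMap.coe_injective ((ext_inner_map _ _).1 fun h => ?_)
    have h1 := inner_opTensor_of_hasSum b (hI.operation x) (hG x) (hV h) T
    rw [← inner_dilate] at h1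
    have h2 := congrArg (starRingEnd ℂ) h1
    rw [inner_conj_symm, inner_conj_symm] at h2
    exact h2.symm

end Stinespring

end QuantumDevice

/-! ### The two equivalences -/

open QuantumDevice in
theorem mainTheorem9 {H : Type u} {K : Type v}
    [NormedAddCommGroup H] [InnerProductSpace ℂ H] [CompleteSpace H] [SeparableSpace H]
    [NormedAddCommGroup K] [InnerProductSpace ℂ K] [CompleteSpace K] [SeparableSpace K]
    (Φ₁ Φ₂ : (K →L[ℂ] K) →ₗ[ℂ] (H →L[ℂ] H)) (hΦ₁ : IsOperation Φ₁) (hΦ₂ : IsOperation Φ₂) :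
    (OperationsCompatible Φ₁ Φ₂ ↔
      ∃ (K' : Type (max u v)) (_ : NormedAddCommGroup K') (_ : InnerProductSpace ℂ K')
        (_ : CompleteSpace K') (_ : SeparableSpace K')
        (V : H →ₗᵢ[ℂ] HilbertTensor K K') (E F : K' →L[ℂ] K'),
        IsEffect E ∧ IsEffect F ∧ EffectsCompatible E F ∧
        (∀ T : K →L[ℂ] K, Φ₁ T = V.toContinuousLinearMap.adjoint ∘L opTensor T E ∘L
          V.toContinuousLinearMap) ∧
        (∀ T : K →L[ℂ] K, Φ₂ T = V.toContinuousLinearMap.adjoint ∘L opTensor T F ∘L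
          V.toContinuousLinearMap)) ∧
    (OperationsWeaklyCompatible Φ₁ Φ₂ ↔
      ∃ (K' : Type (max u v)) (_ : NormedAddCommGroup K') (_ : InnerProductSpace ℂ K')
        (_ : CompleteSpace K') (_ : SeparableSpace K')
        (V : H →ₗᵢ[ℂ] HilbertTensor K K') (E F : K' →L[ℂ] K'),
        IsEffect E ∧ IsEffect F ∧
        (∀ T : K →L[ℂ] K, Φ₁ T = V.toContinuousLinearMap.adjoint ∘L opTensor T E ∘L
          V.toContinuousLinearMap) ∧
        (∀ T : K →L[ℂ] K, Φ₂ T = V.toContinuousLinearMap.adjoint ∘L opTensor T F ∘L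
          V.toContinuousLinearMap)) := by
  refine ⟨⟨?_, ?_⟩, ⟨?_, ?_⟩⟩
  · rintro ⟨Ω, _, I, hI, ⟨X, rfl⟩, ⟨Y, rfl⟩⟩
    obtain ⟨K', _, _, _, _, V, hV⟩ := exists_common_dilation hI.channel
    obtain ⟨G, hG, hsum, hGI⟩ := hV Ω I hI rfl
    refine ⟨K', _, _, ‹_›, ‹_›, V, ∑ x ∈ X, G x, ∑ x ∈ Y, G x, isEffect_of_sum_eq_one hG hsum X,
      isEffect_of_sum_eq_one hG hsum Y, effectsCompatible_of_sum_eq_one hG hsum X Y, ?_, ?_⟩ <;>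
    · intro T
      rw [← dilate_apply, dilate_sum, Finset.sum_congr rfl fun x _ => hGI x]
  · rintro ⟨K', _, _, _, _, V, E, F, -, -, ⟨L, _, _, _, _, Ω, _, I, hI, ⟨X, hX⟩, ⟨Y, hY⟩⟩, h₁, h₂⟩
    obtain ⟨hpos, hsum⟩ := hI.effects
    -- The output space `L` of `I` is discarded: only its POVM `I x 1` on `K'` is kept.
    refine ⟨Ω, _, fun x => dilate V (I x 1), isInstrument_dilate V hpos hsum,
      ⟨X, LinearMap.ext fun T => ?_⟩, ⟨Y, LinearMap.ext fun T => ?_⟩⟩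
    · rw [← dilate_sum, ← LinearMap.sum_apply, ← hX, h₁, dilate_apply]
    · rw [← dilate_sum, ← LinearMap.sum_apply, ← hY, h₂, dilate_apply]
  · rintro ⟨Ω₁, _, Ω₂, _, I₁, I₂, hI₁, hI₂, ⟨X, rfl⟩, ⟨Y, rfl⟩, heq⟩
    obtain ⟨K', _, _, _, _, V, hV⟩ := exists_common_dilation hI₁.channel
    obtain ⟨G₁, hG₁, hsum₁, hGI₁⟩ := hV Ω₁ I₁ hI₁ rfl
    -- Equal total channels let the dilation built from `I₁` serve `I₂` as well.
    obtain ⟨G₂, hG₂, hsum₂, hGI₂⟩ := hV Ω₂ I₂ hI₂ heq.symm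
    refine ⟨K', _, _, ‹_›, ‹_›, V, ∑ x ∈ X, G₁ x, ∑ x ∈ Y, G₂ x,
      isEffect_of_sum_eq_one hG₁ hsum₁ X, isEffect_of_sum_eq_one hG₂ hsum₂ Y,
      fun T => ?_, fun T => ?_⟩
    · rw [← dilate_apply, dilate_sum, Finset.sum_congr rfl fun x _ => hGI₁ x]
    · rw [← dilate_apply, dilate_sum, Finset.sum_congr rfl fun x _ => hGI₂ x]
  · rintro ⟨K', _, _, _, _, V, E, F, hE, hF, h₁, h₂⟩
    obtain ⟨hI, hEI, hsumE⟩ := isInstrument_dilate_effect V hE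
    obtain ⟨hJ, hFJ, hsumF⟩ := isInstrument_dilate_effect V hF
    refine ⟨Bool, _, Bool, _, _, _, hI, hJ, ?_, ?_, hsumE.trans hsumF.symm⟩
    · rwa [show Φ₁ = dilate V E from LinearMap.ext h₁]
    · rwa [show Φ₂ = dilate V F from LinearMap.ext h₂]
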